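/- Let $\Sigma$ be a finite alphabet, and let $A = (Q, \Sigma, q_0, F, \delta)$ be a deterministic finite automaton with $k = |Q|$ states, whose transition function $\delta$ may be partial, and which is trimmed: every state has a path from $q_0$ and a path to some final state. For $q \in Q$, let $A_q$ be the automaton obtained from $A$ by making $q$ the only initial and the only final state, and call $q$ loopable if $L(A_q) \neq \{\epsilon\}$. Two states $q, q'$ are connected if there is a directed path from $q$ to $q'$ or from $q'$ to $q$; two loopable states $q, q'$ are compatible if $L(A_q) \cap L(A_{q'}) \neq \{\epsilon\}$. Assume that $A$ is interchangeable, that is, for any two loopable states $q, q'$ there is a sequence $q = p_0, p_1, \ldots, p_n = q'$ of loopable states in which any two consecutive states are connected or compatible. For words $u, v \in \Sigma^*$, let $\delta_{\mathrm{pp}}(u, v)$ be the push-pop distance, i.e., the minimum number of operations needed to transform $u$ into $v$, where an operation inserts a letter at the beginning or at the end of the word, or removes the first or the last letter of a non-empty word. Then $L(A)$ is $48k^2$-orderable for the push-pop distance: there is a finite or infinite sequence $w_1, w_2, \ldots$ of words of $L(A)$, without repetition, in which every word of $L(A)$ occurs, such that $\delta_{\mathrm{pp}}(w_i, w_{i+1})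 \leq 48k^2$ for any two consecutive words $w_i, w_{i+1}$. -/

import Mathlib

/-- A deterministic automaton over the alphabet `α` with states `σ` and a *partial* transition
function: `step q a = none` means that there is no `a`-transition out of `q`. Finiteness of the
state space is imposed by `[Fintype σ]` where it is needed. -/
structure PartialDFA (α : Type*) (σ : Type*) where
  /-- the partial transition function -/
  step : σ → α → Option σ
  /-- the initial state -/
  start : σ
  /-- the set of final states -/
  accept : Set σ

namespace PartialDFA

variable {α σ : Type*}

/-- `A.evalFrom q w` is the state reached from `q` by the path labelled `w`, if there is one. -/
def evalFrom (A : PartialDFA α σ) : σ → List α → Option σ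
  | q, [] => some q
  | q, a :: w => (A.step q a).bind fun p => A.evalFrom p w

/-- The word `w` is the label of a directed path from `q` to `q'`. -/
def IsPath (A : PartialDFA α σ) (q : σ) (w : List α) (q' : σ) : Prop :=
  A.evalFrom q w = some q'

/-- The language accepted by `A`: the labels of the paths from the initial state to some final
state. -/
def language (A : PartialDFA α σ) : Language α :=
  {w | ∃ q ∈ A.accept, A.IsPath A.start w q}

/-- `A` is trimmed: every state has a path from the initial state and a path to some final
state. -/
def IsTrimmed (A : PartialDFA α σ) : Prop :=
  ∀ q, (∃ w, A.IsPath A.start w q) ∧ ∃ w, ∃ f ∈ A.accept, A.IsPath q w f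

/-- The automaton `A_q`, obtained from `A` by making `q` the only initial and final state. -/
def atState (A : PartialDFA α σ) (q : σ) : PartialDFA α σ where
  step := A.step
  start := q
  accept := {q}

/-- `q` is loopable if `L(A_q) ≠ {ε}`. (In Mathlib, `1 : Language α` is the language `{ε}`.) -/
def Loopable (A : PartialDFA α σ) (q : σ) : Prop :=
  (A.atState q).language ≠ 1

/-- Two states are connected if there is a directed path from one of them to the other. -/
def Connected (A : PartialDFA α σ) (q q' : σ) : Prop :=
  (∃ w, A.IsPath q w q') ∨ ∃ w, A.IsPath q' w q

/-- Two (loopable) states are compatible if `L(A_q) ∩ L(A_q') ≠ {ε}`. -/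
def Compatible (A : PartialDFA α σ) (q q' : σ) : Prop :=
  (A.atState q).language ⊓ (A.atState q').language ≠ 1

/-- One link of a chain of loopable states: both states are loopable, and they are connected or
compatible. -/
def Linked (A : PartialDFA α σ) (q q' : σ) : Prop :=
  A.Loopable q ∧ A.Loopable q' ∧ (A.Connected q q' ∨ A.Compatible q q')

/-- Interchangeability of states: the transitive closure, on loopable states, of the union of
connectivity and compatibility. -/
def InterchangeableStates (A : PartialDFA α σ) : σ → σ → Prop :=
  Relation.TransGen A.Linked

/-- The automaton is interchangeable if all its loopable states are interchangeable. -/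
def IsInterchangeable (A : PartialDFA α σ) : Prop :=
  ∀ q q', A.Loopable q → A.Loopable q' → A.InterchangeableStates q q'

end PartialDFA

/-- The push-pop edit operations. -/
inductive PushPopOp (α : Type*) where
  | pushL (a : α) : PushPopOp α
  | pushR (a : α) : PushPopOp α
  | popL : PushPopOp α
  | popR : PushPopOp α

namespace PushPopOp

variable {α : Type*}

/-- `op.Applies u v`: the operation `op` can be applied to the word `u`, and gives `v`. -/
def Applies : PushPopOp α → List α → List α → Prop
  | pushL a, u, v => v = a :: u
  | pushR a, u, v => v = u ++ [a]
  | popL, u, v => ∃ a, u = a :: v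
  | popR, u, v => ∃ a, u = v ++ [a]

/-- `ScriptApplies s u v`: applying the operations of the edit script `s` one after the other
transforms `u` into `v`. -/
def ScriptApplies : List (PushPopOp α) → List α → List α → Prop
  | [], u, v => u = v
  | op :: s, u, v => ∃ u', op.Applies u u' ∧ ScriptApplies s u' v

end PushPopOp

/-- The push-pop edit distance: the minimum number of push-pop operations needed to transform
`u` into `v`. -/
noncomputable def pushPopDist {α : Type*} (u v : List α) : ℕ :=
  sInf {n | ∃ s : List (PushPopOp α), s.length = n ∧ PushPopOp.ScriptApplies s u v}

/-- The infimum in `pushPopDist` is over a non-empty set, hence is a minimum. -/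
theorem exists_script_length_eq_pushPopDist {α : Type*} (u v : List α) :
    ∃ s : List (PushPopOp α), s.length = pushPopDist u v ∧ PushPopOp.ScriptApplies s u v := by
  have push : ∀ v w : List α, ∃ s, PushPopOp.ScriptApplies s w (w ++ v) := by
    intro v
    induction v with
    | nil => exact fun w => ⟨[], by simp [PushPopOp.ScriptApplies]⟩
    | cons a v ih =>
      intro w
      obtain ⟨s, hs⟩ := ih (w ++ [a])
      exact ⟨.pushR a :: s, w ++ [a], rfl, by simpa using hs⟩
  have all : ∃ s, PushPopOp.ScriptApplies s u v := by
    induction u with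
    | nil => simpa using push v []
    | cons a u ih =>
      obtain ⟨s, hs⟩ := ih
      exact ⟨.popL :: s, u, ⟨a, rfl⟩, hs⟩
  obtain ⟨s, hs⟩ := all
  exact Nat.sInf_mem
    (s := {n | ∃ s : List (PushPopOp α), s.length = n ∧ PushPopOp.ScriptApplies s u v})
    ⟨s.length, s, rfl, hs⟩

section Orderability

variable {α : Type*}

/-- A finite `d`-sequence in `L` for the distance `δ`: words of `L`, without repetition, any two
consecutive ones being at distance at most `d`. -/
def IsFiniteDSequence (δ : List α → List α → ℕ) (d : ℕ) (L : Language α)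
    (s : List (List α)) : Prop :=
  (∀ w ∈ s, w ∈ L) ∧ s.Nodup ∧ s.IsChain fun u v => δ u v ≤ d

/-- An infinite `d`-sequence in `L` for the distance `δ`. -/
def IsInfiniteDSequence (δ : List α → List α → ℕ) (d : ℕ) (L : Language α)
    (s : ℕ → List α) : Prop :=
  (∀ i, s i ∈ L) ∧ Function.Injective s ∧ ∀ i, δ (s i) (s (i + 1)) ≤ d

/-- `L` is `d`-orderable for the distance `δ`: some finite or infinite `d`-sequence in `L`
contains every word of `L`. -/
def IsOrderable (δ : List α → List α → ℕ) (d : ℕ) (L : Language α) : Prop :=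
  (∃ s, IsFiniteDSequence δ d L s ∧ ∀ w ∈ L, w ∈ s) ∨
    ∃ s, IsInfiniteDSequence δ d L s ∧ ∀ w ∈ L, ∃ i, s i = w

end Orderability

/-! Cut the language into strata, the `i`-th one holding the words whose length lies in `[2ki,
2k(i+1))`. Each stratum is finite. If each is connected under steps of at most `16k²`, then its cube
has Hamiltonian paths (`exists_isHamiltonian`), whose steps cost at most `48k²`; these paths are
then chained from one stratum to the next.

Connectivity of a stratum comes from windows: a path label of length exactly `2ki`, completed at
both ends by words shorter than `k`, is a word of stratum `i`. Sliding the window by one letter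
along a path is a cheap step, so windows on a common path are joined (`joined_word_of_path`).
Compatible states share a loop `e`, hence also share a window, a prefix of `eee...`; so
interchangeability joins the windows read around any two loopable states. Finally, for `i ≠ 0`, a
word of the stratum contains a loop shortly before position `2ki`, and changing its ends makes it a
window that slides into that loop (`exists_joined_loop`). -/

/-! ### Hamiltonian paths in the cube of a finite connected graph. -/

namespace CubeHamiltonian

variable {β : Type*}

/-- Every two elements of `S` are joined by an `R`-walk inside `S`. -/
def ConnectedOn (R : β → β → Prop) (S : Finset β) : Prop :=
  ∀ a ∈ S, ∀ b ∈ S, Relation.ReflTransGen (fun x y => R x y ∧ x ∈ S ∧ y ∈ S) a b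

/-- The cube of a relation. -/
def Cube (R : β → β → Prop) (x y : β) : Prop :=
  ∃ a b, R x a ∧ R a b ∧ R b y

/-- The list `l` enumerates `S` without repetition, from `u` to `v`, along the cube of `R`. -/
structure IsHamiltonian (R : β → β → Prop) (S : Finset β) (u v : β) (l : List β) : Prop where
  nodup : l.Nodup
  mem_iff : ∀ x, x ∈ l ↔ x ∈ S
  head : l.head? = some u
  last : l.getLast? = some v
  chain : l.IsChain (Cube R)

theorem IsHamiltonian.singleton (R : β → β → Prop) (u : β) : IsHamiltonian R {u} u u [u] :=
  ⟨by simp, by simp, by simp, by simp, by simp⟩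

theorem IsHamiltonian.reverse {R : β → β → Prop} (hs : ∀ x y, R x y → R y x) {S : Finset β}
    {u v : β} {l : List β} (h : IsHamiltonian R S u v l) : IsHamiltonian R S v u l.reverse := by
  refine ⟨by simpa using h.nodup, by simpa using h.mem_iff, by simpa using h.last,
    by simpa using h.head, ?_⟩
  rw [List.isChain_reverse]
  refine h.chain.imp ?_
  rintro x y ⟨a, b, h1, h2, h3⟩
  exact ⟨b, a, hs _ _ h3, hs _ _ h2, hs _ _ h1⟩

theorem ConnectedOn.exists_adj {R : β → β → Prop} {S : Finset β} (hc : ConnectedOn R S)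
    {v : β} (hv : v ∈ S) (hne : S ≠ {v}) : ∃ u ∈ S, u ≠ v ∧ R u v := by
  obtain ⟨w, hw, hwv⟩ : ∃ w ∈ S, w ≠ v := by
    by_contra! h
    exact hne (Finset.eq_singleton_iff_unique_mem.2 ⟨hv, h⟩)
  have key : ∀ a, Relation.ReflTransGen (fun x y => R x y ∧ x ∈ S ∧ y ∈ S) a v → a ≠ v →
      ∃ u ∈ S, u ≠ v ∧ R u v := by
    intro a h
    induction h using Relation.ReflTransGen.head_induction_on with
    | refl => exact fun h => absurd rfl h
    | head h1 _ ih =>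
      intro hne
      rename_i x y _
      by_cases hy : y = v
      · subst hy
        exact ⟨x, h1.2.1, hne, h1.1⟩
      · exact ih hy
  exact key w (hc w hw v hv) hwv

/-- The cube of a finite connected graph has a Hamiltonian path between any two vertices. -/
theorem exists_isHamiltonian {R : β → β → Prop} (hr : ∀ x, R x x) (hs : ∀ x y, R x y → R y x)
    (n : ℕ) : ∀ S : Finset β, S.card ≤ n → ConnectedOn R S → ∀ u ∈ S, ∀ v ∈ S, u ≠ v →
      ∃ l, IsHamiltonian R S u v l := by
  classical
  induction n with
  | zero =>
    intro S hS _ u hu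
    simp only [nonpos_iff_eq_zero, Finset.card_eq_zero] at hS
    simp [hS] at hu
  | succ n ih =>
    intro S hS hc u hu v hv huv
    -- Reflexivity of `R` lets a singleton count as a path whose two ends are adjacent.
    have ih' : ∀ S' : Finset β, S'.card ≤ n → ConnectedOn R S' → ∀ a ∈ S',
        ∃ b ∈ S', R a b ∧ ∃ l, IsHamiltonian R S' a b l := by
      intro S' hS' hc' a ha
      by_cases h : S' = {a}
      · exact ⟨a, ha, hr a, [a], h ▸ IsHamiltonian.singleton R a⟩
      · obtain ⟨b, hb, hba, hR⟩ := hc'.exists_adj ha h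
        exact ⟨b, hb, hs _ _ hR, ih S' hS' hc' a ha b hb hba.symm⟩
    let E : β → β → Prop := fun x y => R x y ∧ (x ∈ S ∧ x ≠ u) ∧ (y ∈ S ∧ y ≠ u)
    have hEs : ∀ x y, E x y → E y x := fun x y h => ⟨hs _ _ h.1, h.2.2, h.2.1⟩
    -- `C` is the component of `v` once `u` is deleted. The other components all hang on `u`, so the
    -- complement `D` of `C` is connected too.
    let C : Finset β := S.filter fun x => Relation.ReflTransGen E v x
    let D : Finset β := S.filter fun x => ¬ Relation.ReflTransGen E v x
    have hCu : ∀ x, Relation.ReflTransGen E v x → x ≠ u := by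
      intro x hx
      induction hx with
      | refl => exact huv.symm
      | tail _ h _ => exact h.2.2.2
    have hvC : v ∈ C := by simp [C, hv, Relation.ReflTransGen.refl]
    have huD : u ∈ D := by
      simp only [D, Finset.mem_filter, hu, true_and]
      exact fun h => hCu u h rfl
    have hCcard : C.card ≤ n := by
      have : C.card < S.card := Finset.card_lt_card (Finset.filter_ssubset.2 ⟨u, hu, fun h => hCu u h rfl⟩)
      omega
    have hDcard : D.card ≤ n := by
      have : D.card < S.card := Finset.card_lt_card
        (Finset.filter_ssubset.2 ⟨v, hv, fun h => h Relation.ReflTransGen.refl⟩)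
      omega
    have symE : ∀ (F : β → β → Prop), (∀ x y, F x y → F y x) → ∀ a b,
        Relation.ReflTransGen F a b → Relation.ReflTransGen F b a :=
      fun F hF a b h => (@Relation.ReflTransGen.stdSymm _ F ⟨hF⟩).symm a b h
    have hCc : ConnectedOn R C := by
      have h1 : ∀ a, Relation.ReflTransGen E v a →
          Relation.ReflTransGen (fun x y => R x y ∧ x ∈ C ∧ y ∈ C) v a := by
        intro a h
        induction h with
        | refl => exact .refl
        | tail h0 h ih =>
          exact ih.tail ⟨h.1, by simp [C, h.2.1.1, h0], by simp [C, h.2.2.1, h0.tail h]⟩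
      have hF : ∀ x y, (R x y ∧ x ∈ C ∧ y ∈ C) → (R y x ∧ y ∈ C ∧ x ∈ C) :=
        fun x y h => ⟨hs _ _ h.1, h.2.2, h.2.1⟩
      intro a ha b hb
      exact (symE _ hF _ _ (h1 a (Finset.mem_filter.1 ha).2)).trans
        (h1 b (Finset.mem_filter.1 hb).2)
    have hDc : ConnectedOn R D := by
      have h1 : ∀ a, Relation.ReflTransGen (fun x y => R x y ∧ x ∈ S ∧ y ∈ S) a u → a ∈ D →
          Relation.ReflTransGen (fun x y => R x y ∧ x ∈ D ∧ y ∈ D) a u := by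
        intro a h
        induction h using Relation.ReflTransGen.head_induction_on with
        | refl => exact fun _ => .refl
        | head h _ ih =>
          intro ha
          rename_i x y _
          by_cases hx : x = u
          · subst hx; exact .refl
          have hy : y ∈ D := by
            by_cases hyu : y = u
            · subst hyu; exact huD
            · simp only [D, Finset.mem_filter] at ha ⊢
              exact ⟨h.2.2, fun hvy => ha.2 (hvy.tail ⟨hs _ _ h.1, ⟨h.2.2, hyu⟩, ⟨h.2.1, hx⟩⟩)⟩
          exact .head ⟨h.1, ha, hy⟩ (ih hy)
      have hF : ∀ x y, (R x y ∧ x ∈ D ∧ y ∈ D) → (R y x ∧ y ∈ D ∧ x ∈ D) :=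
        fun x y h => ⟨hs _ _ h.1, h.2.2, h.2.1⟩
      intro a ha b hb
      exact (h1 a (hc a (Finset.mem_filter.1 ha).1 u hu) ha).trans
        (symE _ hF _ _ (h1 b (hc b (Finset.mem_filter.1 hb).1 u hu) hb))
    obtain ⟨x, hxC, hux⟩ : ∃ x ∈ C, R u x := by
      have h1 : ∀ a, Relation.ReflTransGen (fun x y => R x y ∧ x ∈ S ∧ y ∈ S) a u → a ∈ C →
          ∃ x ∈ C, R u x := by
        intro a h
        induction h using Relation.ReflTransGen.head_induction_on with
        | refl => exact fun h => absurd rfl (hCu u (Finset.mem_filter.1 h).2)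
        | head h _ ih =>
          intro ha
          rename_i x y _
          by_cases hyu : y = u
          · subst hyu; exact ⟨x, ha, hs _ _ h.1⟩
          · have ha' := (Finset.mem_filter.1 ha).2
            exact ih (Finset.mem_filter.2 ⟨h.2.2, ha'.tail ⟨h.1, ⟨h.2.1, hCu _ ha'⟩, h.2.2, hyu⟩⟩)
      exact h1 v (hc v hv u hu) hvC
    obtain ⟨u', -, huu', l₁, hl₁⟩ := ih' D hDcard hDc u huD
    obtain ⟨x', hxx', l₂, hl₂⟩ : ∃ x', R x x' ∧ ∃ l, IsHamiltonian R C x' v l := by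
      by_cases hxv : x = v
      · subst hxv
        obtain ⟨x', -, h, l, hl⟩ := ih' C hCcard hCc x hxC
        exact ⟨x', h, _, hl.reverse hs⟩
      · exact ⟨x, hr x, ih C hCcard hCc x hxC v hvC hxv⟩
    -- Traverse `D` from `u` to `u'`, then `C` from `x'` to `v`. The jump from `u'` to `x'` follows
    -- the three edges `u' u`, `u x`, `x x'`.
    refine ⟨l₁ ++ l₂, ⟨?_, ?_, by simp [hl₁.head], by simp [hl₂.last], ?_⟩⟩
    · refine List.nodup_append'.2 ⟨hl₁.nodup, hl₂.nodup, ?_⟩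
      intro a h1 h2
      rw [hl₁.mem_iff] at h1
      rw [hl₂.mem_iff] at h2
      exact (Finset.mem_filter.1 h1).2 (Finset.mem_filter.1 h2).2
    · intro a
      rw [List.mem_append, hl₁.mem_iff, hl₂.mem_iff, or_comm, ← Finset.mem_union]
      simp only [C, D, Finset.filter_union_filter_not_eq]
    · refine List.isChain_append.2 ⟨hl₁.chain, hl₂.chain, ?_⟩
      intro a ha b hb
      rw [hl₁.last] at ha
      rw [hl₂.head] at hb
      cases ha
      cases hb
      exact ⟨u, x, hs _ _ huu', hux, hxx'⟩

theorem ConnectedOn.exists_isHamiltonian_to {R : β → β → Prop} (hr : ∀ x, R x x)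
    (hs : ∀ x y, R x y → R y x) {S : Finset β} (hc : ConnectedOn R S) {v : β} (hv : v ∈ S) :
    ∃ u, R u v ∧ ∃ l, IsHamiltonian R S u v l := by
  by_cases h : S = {v}
  · exact ⟨v, hr v, [v], h ▸ IsHamiltonian.singleton R v⟩
  · obtain ⟨u, hu, huv, hR⟩ := hc.exists_adj hv h
    exact ⟨u, hR, exists_isHamiltonian hr hs _ S le_rfl hc u hu v hv huv⟩

/-! ### Gluing finite lists into an infinite sequence. -/

/-- The concatenation of the first `n` lists of a sequence. -/
def concat (l : ℕ → List β) : ℕ → List β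
  | 0 => []
  | n + 1 => concat l n ++ l n

theorem mem_concat {l : ℕ → List β} {n : ℕ} {x : β} : x ∈ concat l n ↔ ∃ i < n, x ∈ l i := by
  induction n with
  | zero => simp [concat]
  | succ n ih =>
    simp only [concat, List.mem_append, ih]
    constructor
    · rintro (⟨i, hi, h⟩ | h)
      · exact ⟨i, by omega, h⟩
      · exact ⟨n, by omega, h⟩
    · rintro ⟨i, hi, h⟩
      rcases Nat.lt_succ_iff_lt_or_eq.1 hi with hi | rfl
      · exact Or.inl ⟨i, hi, h⟩
      · exact Or.inr h

theorem concat_prefix (l : ℕ → List β) {m n : ℕ} (h : m ≤ n) : concat l m <+: concat l n := by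
  induction h with
  | refl => exact List.prefix_rfl
  | step _ ih => exact ih.trans (List.prefix_append _ _)

/-- Infinitely many non-empty pairwise disjoint lists, each linked to the next one, form an infinite
sequence without repetition. -/
theorem exists_seq_of_lists (T : β → β → Prop) (l : ℕ → List β) (hne : ∀ i, l i ≠ [])
    (hnd : ∀ i, (l i).Nodup) (hdisj : ∀ i j x, x ∈ l i → x ∈ l j → i = j)
    (hch : ∀ i, (l i).IsChain T)
    (hlink : ∀ i, ∀ x ∈ (l i).getLast?, ∀ y ∈ (l (i + 1)).head?, T x y) :
    ∃ s : ℕ → β, Function.Injective s ∧ (∀ n, T (s n) (s (n + 1))) ∧ (∀ n, ∃ i, s n ∈ l i) ∧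
      ∀ i, ∀ x ∈ l i, ∃ n, s n = x := by
  have hlen : ∀ n, n ≤ (concat l n).length := by
    intro n
    induction n with
    | zero => simp
    | succ n ih =>
      have := List.length_pos_iff.2 (hne n)
      simp only [concat, List.length_append]
      omega
  have hnodup : ∀ n, (concat l n).Nodup := by
    intro n
    induction n with
    | zero => simp [concat]
    | succ n ih =>
      refine List.nodup_append'.2 ⟨ih, hnd n, ?_⟩
      intro a h1 h2
      obtain ⟨i, hi, h⟩ := mem_concat.1 h1
      have := hdisj i n a h h2
      omega
  have hchain : ∀ n, (concat l n).IsChain T := by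
    intro n
    induction n with
    | zero => simp [concat]
    | succ n ih =>
      refine List.isChain_append.2 ⟨ih, hch n, ?_⟩
      intro x hx y hy
      cases n with
      | zero => simp [concat] at hx
      | succ n =>
        refine hlink n x ?_ y hy
        simpa [concat, List.getLast?_append_of_ne_nil _ (hne n)] using hx
  have hlt : ∀ n, n < (concat l (n + 1)).length := fun n => hlen (n + 1)
  -- The lists are non-empty, so `n + 1` of them reach index `n`; as the concatenations are prefixes
  -- of one another, any long enough one gives the same entry.
  let s : ℕ → β := fun n => (concat l (n + 1))[n]'(hlt n)
  have hs : ∀ m n (h : n < (concat l m).length), s n = (concat l m)[n] := by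
    intro m n h
    rcases le_total m (n + 1) with hm | hm
    · exact ((concat_prefix l hm).getElem h).symm
    · exact (concat_prefix l hm).getElem (hlt n)
  refine ⟨s, ?_, ?_, ?_, ?_⟩
  · intro a b hab
    have ha : a < (concat l (max a b + 1)).length := lt_of_lt_of_le (by omega) (hlen _)
    have hb : b < (concat l (max a b + 1)).length := lt_of_lt_of_le (by omega) (hlen _)
    rw [hs _ _ ha, hs _ _ hb] at hab
    exact (hnodup _).getElem_inj_iff.1 hab
  · intro n
    have h := hlt (n + 1)
    rw [hs _ _ h, hs (n + 1 + 1) n (by omega)]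
    exact List.isChain_iff_getElem.1 (hchain _) n h
  · intro n
    obtain ⟨i, -, h⟩ := mem_concat.1 (List.getElem_mem (hlt n))
    exact ⟨i, h⟩
  · intro i x hx
    have : x ∈ concat l (i + 1) := mem_concat.2 ⟨i, by omega, hx⟩
    obtain ⟨n, hn, h⟩ := List.mem_iff_getElem.1 this
    exact ⟨n, by rw [hs _ _ hn, h]⟩

end CubeHamiltonian

/-! ### The push-pop distance: metric properties and the common factor bound. -/

theorem PushPopOp.ScriptApplies.append {α : Type*} {s₁ s₂ : List (PushPopOp α)} {u v w : List α}
    (h₁ : ScriptApplies s₁ u v) (h₂ : ScriptApplies s₂ v w) : ScriptApplies (s₁ ++ s₂) u w := by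
  induction s₁ generalizing u with
  | nil => cases h₁; exact h₂
  | cons op s₁ ih =>
    obtain ⟨u', h, h'⟩ := h₁
    exact ⟨u', h, ih h'⟩

section PushPop

variable {α : Type*}

theorem pushPopDist_le_length {s : List (PushPopOp α)} {u v : List α}
    (h : PushPopOp.ScriptApplies s u v) : pushPopDist u v ≤ s.length :=
  Nat.sInf_le ⟨s, rfl, h⟩

theorem pushPopDist_self (u : List α) : pushPopDist u u = 0 :=
  Nat.le_zero.1 (pushPopDist_le_length (s := []) rfl)

theorem pushPopDist_triangle (u v w : List α) :
    pushPopDist u w ≤ pushPopDist u v + pushPopDist v w := by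
  obtain ⟨s₁, h₁, h₁'⟩ := exists_script_length_eq_pushPopDist u v
  obtain ⟨s₂, h₂, h₂'⟩ := exists_script_length_eq_pushPopDist v w
  simpa [h₁, h₂] using pushPopDist_le_length (h₁'.append h₂')

theorem PushPopOp.Applies.pushPopDist_le_one {op : PushPopOp α} {u v : List α}
    (h : op.Applies u v) : pushPopDist u v ≤ 1 :=
  pushPopDist_le_length (s := [op]) ⟨v, h, rfl⟩

theorem PushPopOp.exists_applies_symm {op : PushPopOp α} {u v : List α} (h : op.Applies u v) :
    ∃ op' : PushPopOp α, op'.Applies v u := by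
  cases op with
  | pushL a => exact ⟨.popL, a, h⟩
  | pushR a => exact ⟨.popR, a, h⟩
  | popL => obtain ⟨a, h⟩ := h; exact ⟨.pushL a, h⟩
  | popR => obtain ⟨a, h⟩ := h; exact ⟨.pushR a, h⟩

theorem PushPopOp.ScriptApplies.pushPopDist_symm_le {s : List (PushPopOp α)} {u v : List α}
    (h : ScriptApplies s u v) : pushPopDist v u ≤ s.length := by
  induction s generalizing u with
  | nil => cases h; simp [pushPopDist_self]
  | cons op s ih =>
    obtain ⟨u', h, h'⟩ := h
    obtain ⟨op', hop⟩ := PushPopOp.exists_applies_symm h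
    have h1 := pushPopDist_triangle v u' u
    have h2 := ih h'
    have h3 := hop.pushPopDist_le_one
    simp only [List.length_cons]
    omega

theorem pushPopDist_comm_le (u v : List α) : pushPopDist v u ≤ pushPopDist u v := by
  obtain ⟨s, h, h'⟩ := exists_script_length_eq_pushPopDist u v
  exact h ▸ h'.pushPopDist_symm_le

theorem pushPopDist_append_left_le (a x : List α) : pushPopDist (a ++ x) x ≤ a.length := by
  induction a with
  | nil => simp [pushPopDist_self]
  | cons c a ih =>
    have h1 := pushPopDist_triangle (c :: a ++ x) (a ++ x) x
    have h2 := PushPopOp.Applies.pushPopDist_le_one (op := .popL) (u := c :: a ++ x)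
      (v := a ++ x) ⟨c, rfl⟩
    simp only [List.length_cons]
    omega

theorem pushPopDist_append_right_le (x b : List α) : pushPopDist (x ++ b) x ≤ b.length := by
  induction b using List.reverseRecOn with
  | nil => simp [pushPopDist_self]
  | append_singleton b c ih =>
    have h1 := pushPopDist_triangle (x ++ (b ++ [c])) (x ++ b) x
    have h2 := PushPopOp.Applies.pushPopDist_le_one (op := .popR) (u := x ++ (b ++ [c]))
      (v := x ++ b) ⟨c, by simp⟩
    simp only [List.length_append, List.length_singleton]
    omega

/-- Two words with a common factor are transformed into each other by changing the ends. -/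
theorem pushPopDist_le_of_common_factor (a x b a' b' : List α) :
    pushPopDist (a ++ x ++ b) (a' ++ x ++ b') ≤ a.length + b.length + a'.length + b'.length := by
  have h1 := pushPopDist_triangle (a ++ x ++ b) x (a' ++ x ++ b')
  have h2 := pushPopDist_triangle (a ++ x ++ b) (a ++ x) x
  have h3 := pushPopDist_triangle (a' ++ x ++ b') (a' ++ x) x
  have h4 := pushPopDist_append_right_le (a ++ x) b
  have h5 := pushPopDist_append_right_le (a' ++ x) b'
  have h6 := pushPopDist_append_left_le a x
  have h7 := pushPopDist_append_left_le a' x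
  have h8 := pushPopDist_comm_le (a' ++ x ++ b') x
  omega

end PushPop

/-! ### Paths, loops and pumping in a partial automaton. -/

namespace PartialDFA

variable {α σ : Type*} {A : PartialDFA α σ} {p q r : σ} {u v w : List α}

theorem IsPath.append (h₁ : A.IsPath p u q) (h₂ : A.IsPath q v r) : A.IsPath p (u ++ v) r := by
  induction u generalizing p with
  | nil => cases h₁; exact h₂
  | cons a u ih =>
    obtain ⟨p', h, h'⟩ := Option.bind_eq_some_iff.1 h₁
    exact Option.bind_eq_some_iff.2 ⟨p', h, ih h'⟩

theorem IsPath.split (h : A.IsPath p (u ++ v) r) : ∃ q, A.IsPath p u q ∧ A.IsPath q v r := by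
  induction u generalizing p with
  | nil => exact ⟨p, rfl, h⟩
  | cons a u ih =>
    obtain ⟨p', h, h'⟩ := Option.bind_eq_some_iff.1 h
    obtain ⟨q, h1, h2⟩ := ih h'
    exact ⟨q, Option.bind_eq_some_iff.2 ⟨p', h, h1⟩, h2⟩

theorem IsPath.unique (h₁ : A.IsPath p u q) (h₂ : A.IsPath p u r) : q = r :=
  Option.some_injective _ (h₁.symm.trans h₂)

theorem isPath_nil (A : PartialDFA α σ) (p : σ) : A.IsPath p [] p := rfl

theorem evalFrom_atState (A : PartialDFA α σ) (q p : σ) (w : List α) :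
    (A.atState q).evalFrom p w = A.evalFrom p w := by
  induction w generalizing p with
  | nil => rfl
  | cons a w ih => simp only [evalFrom, ih]; rfl

theorem mem_language_atState : w ∈ (A.atState q).language ↔ A.IsPath q w q := by
  constructor
  · rintro ⟨p, hp, h⟩
    cases hp
    exact (evalFrom_atState A q q w).symm.trans h
  · intro h
    exact ⟨q, rfl, (evalFrom_atState A q q w).trans h⟩

theorem _root_.Language.exists_ne_nil_of_ne_one {L : Language α} (h0 : [] ∈ L) (h : L ≠ 1) :
    ∃ w ∈ L, w ≠ [] := by
  by_contra! hc
  refine h (Set.ext fun w => ?_)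
  constructor
  · exact fun hw => hc w hw
  · rintro rfl
    exact h0

theorem loopable_iff : A.Loopable q ↔ ∃ e ≠ [], A.IsPath q e q := by
  constructor
  · intro h
    obtain ⟨w, hw, hne⟩ := Language.exists_ne_nil_of_ne_one
      (mem_language_atState.2 (A.isPath_nil q)) h
    exact ⟨w, hne, mem_language_atState.1 hw⟩
  · rintro ⟨e, hne, he⟩ h
    have := mem_language_atState.2 he
    rw [h] at this
    exact hne this

theorem Compatible.exists_loop (h : A.Compatible p q) :
    ∃ e ≠ [], A.IsPath p e p ∧ A.IsPath q e q := by
  obtain ⟨w, hw, hne⟩ := Language.exists_ne_nil_of_ne_one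
    (L := (A.atState p).language ⊓ (A.atState q).language)
    ⟨mem_language_atState.2 (A.isPath_nil p), mem_language_atState.2 (A.isPath_nil q)⟩ h
  exact ⟨w, hne, mem_language_atState.1 hw.1, mem_language_atState.1 hw.2⟩

/-- A path with at least as many letters as there are states contains a loop. -/
theorem IsPath.exists_loop [Fintype σ] (h : A.IsPath p w r) (hw : Fintype.card σ ≤ w.length) :
    ∃ a b c q, w = a ++ b ++ c ∧ b ≠ [] ∧ A.IsPath p a q ∧ A.IsPath q b q ∧ A.IsPath q c r := by
  have hst : ∀ i : ℕ, ∃ q, A.IsPath p (w.take i) q ∧ A.IsPath q (w.drop i) r := fun i =>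
    IsPath.split (by rwa [List.take_append_drop])
  choose st h1 h2 using hst
  -- Pigeonhole on the states reached after the prefixes of lengths `0, ..., k`.
  obtain ⟨i, j, hij, hst⟩ : ∃ i j : Fin (Fintype.card σ + 1), i < j ∧ st i = st j := by
    obtain ⟨i, j, hne, h⟩ := Fintype.exists_ne_map_eq_of_card_lt
      (fun i : Fin (Fintype.card σ + 1) => st i) (by simp)
    rcases lt_or_gt_of_ne hne with hlt | hlt
    · exact ⟨i, j, hlt, h⟩
    · exact ⟨j, i, hlt, h.symm⟩
  have hij' : (i : ℕ) < j := hij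
  have hj := j.2
  have htake : w.take j = w.take i ++ (w.drop i).take (j - i) := by
    rw [← List.take_add]
    congr 1
    omega
  refine ⟨w.take i, (w.drop i).take (j - i), w.drop j, st i, ?_, ?_, h1 i, ?_, ?_⟩
  · rw [← htake, List.take_append_drop]
  · intro h0
    have := congrArg List.length h0
    simp at this
    omega
  · have h3 := h1 j
    rw [htake] at h3
    obtain ⟨q, hq, hq'⟩ := h3.split
    rw [(h1 i).unique hq]
    rw [← hst, (h1 i).unique hq] at hq'
    exact hq'
  · rw [hst]; exact h2 j

/-- Cut out loops until fewer than `k` letters remain. -/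
theorem IsPath.exists_short [Fintype σ] (h : A.IsPath p w r) :
    ∃ w', w'.length < Fintype.card σ ∧ A.IsPath p w' r := by
  induction hn : w.length using Nat.strong_induction_on generalizing w with
  | _ n ih =>
    by_cases hw : w.length < Fintype.card σ
    · exact ⟨w, hw, h⟩
    · obtain ⟨a, b, c, q, rfl, hb, ha, -, hc⟩ := h.exists_loop (not_lt.1 hw)
      have := List.length_pos_iff.2 hb
      exact ih _ (by simp at hn ⊢; omega) (ha.append hc) rfl

/-- The prefix of length `n` of the infinite repetition of the non-empty word `e`. -/
def loopPrefix (e : List α) (n : ℕ) : List α :=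
  (List.replicate n e).flatten.take n

theorem length_loopPrefix {e : List α} (he : e ≠ []) (n : ℕ) : (loopPrefix e n).length = n := by
  have := List.length_pos_iff.2 he
  simp only [loopPrefix, List.length_take, List.length_flatten, List.map_replicate,
    List.sum_replicate, smul_eq_mul]
  exact min_eq_left (Nat.le_mul_of_pos_right _ this)

theorem loopPrefix_add {e : List α} (he : e ≠ []) (m n : ℕ) :
    ∃ v, v.length = n ∧ loopPrefix e (m + n) = loopPrefix e m ++ v := by
  have hp : loopPrefix e m <+: loopPrefix e (m + n) := by
    have h0 := List.length_pos_iff.2 he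
    have h1 : loopPrefix e m = (List.replicate (m + n) e).flatten.take m := by
      rw [List.replicate_add, List.flatten_append, List.take_append_of_le_length, loopPrefix]
      simp only [List.length_flatten, List.map_replicate, List.sum_replicate, smul_eq_mul]
      exact Nat.le_mul_of_pos_right _ h0
    rw [h1]
    exact List.take_prefix_take_left (by omega)
  obtain ⟨v, hv⟩ := hp
  refine ⟨v, ?_, hv.symm⟩
  have := congrArg List.length hv
  simp only [List.length_append, length_loopPrefix he] at this
  omega

theorem IsPath.loopPrefix {e : List α} (h : A.IsPath q e q) (n : ℕ) :
    ∃ r z, A.IsPath q (loopPrefix e n) r ∧ A.IsPath r z q := by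
  have hp : ∀ m, A.IsPath q (List.replicate m e).flatten q := by
    intro m
    induction m with
    | zero => exact rfl
    | succ m ih => simpa [List.replicate_succ] using h.append ih
  have h1 := hp n
  rw [← List.take_append_drop n (List.replicate n e).flatten] at h1
  obtain ⟨r, h2, h3⟩ := h1.split
  exact ⟨r, _, h2, h3⟩

end PartialDFA

/-! ### Connectivity of the strata, by sliding windows. -/

namespace PartialDFA

variable {α σ : Type*} {A : PartialDFA α σ} {p q r : σ} {u v w x : List α}

/-- The words of the language whose length lies in the `i`-th interval of `m` integers. -/
def stratum (A : PartialDFA α σ) (m i : ℕ) : Set (List α) :=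
  {w | w ∈ A.language ∧ w.length / m = i}

theorem finite_stratum [Finite α] (A : PartialDFA α σ) {m : ℕ} (hm : 0 < m) (i : ℕ) :
    (A.stratum m i).Finite := by
  refine (List.finite_length_lt α (m * (i + 1))).subset ?_
  rintro w ⟨-, rfl⟩
  exact Nat.lt_mul_div_succ _ hm

/-- The words `u` and `v` are joined by a walk in the `i`-th stratum of width `2k`, where `k` is
the number of states, with steps of length at most `16k²`. -/
def Joined [Fintype σ] (A : PartialDFA α σ) (i : ℕ) : List α → List α → Prop :=
  Relation.ReflTransGen fun u v => pushPopDist u v ≤ 16 * Fintype.card σ ^ 2 ∧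
    u ∈ A.stratum (2 * Fintype.card σ) i ∧ v ∈ A.stratum (2 * Fintype.card σ) i

theorem Joined.symm [Fintype σ] {i : ℕ} (h : A.Joined i u v) : A.Joined i v u :=
  (@Relation.ReflTransGen.stdSymm _ _
    ⟨fun _ _ h => ⟨(pushPopDist_comm_le _ _).trans h.1, h.2.2, h.2.1⟩⟩).symm _ _ h

/-- Every elementary step built below meets this linear bound. -/
theorem joined_of_le [Fintype σ] {i : ℕ} (h : pushPopDist u v ≤ 8 * Fintype.card σ)
    (hu : u ∈ A.stratum (2 * Fintype.card σ) i) (hv : v ∈ A.stratum (2 * Fintype.card σ) i) :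
    A.Joined i u v :=
  .single ⟨h.trans (by nlinarith [Nat.le_self_pow two_ne_zero (Fintype.card σ)]), hu, hv⟩

/-- A choice, for every state, of short words leading to it from the initial state and from it
to a final state. -/
structure ShortEnds [Fintype σ] (A : PartialDFA α σ) where
  /-- a word leading from the initial state to a given state -/
  pre : σ → List α
  /-- a word leading from a given state to a final state -/
  post : σ → List α
  isPath_pre : ∀ p, A.IsPath A.start (pre p) p
  length_pre : ∀ p, (pre p).length < Fintype.card σ
  isPath_post : ∀ p, ∃ f ∈ A.accept, A.IsPath p (post p) f
  length_post : ∀ p, (post p).length < Fintype.card σ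

theorem IsTrimmed.nonempty_shortEnds [Fintype σ] (h : A.IsTrimmed) : Nonempty A.ShortEnds := by
  have h1 : ∀ p, ∃ w, w.length < Fintype.card σ ∧ A.IsPath A.start w p := fun p =>
    let ⟨_, hw⟩ := (h p).1
    hw.exists_short
  have h2 : ∀ p, ∃ w, w.length < Fintype.card σ ∧ ∃ f ∈ A.accept, A.IsPath p w f := by
    intro p
    obtain ⟨w, f, hf, hw⟩ := (h p).2
    obtain ⟨w', h1, h2⟩ := hw.exists_short
    exact ⟨w', h1, f, hf, h2⟩
  choose s hs hs' using h1
  choose t ht ht' using h2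
  exact ⟨⟨s, t, hs', hs, ht', ht⟩⟩

namespace ShortEnds

variable [Fintype σ] (E : A.ShortEnds) {i : ℕ}

/-- The path label `x` from `p` to `r`, completed to a word of the language. -/
def word (p : σ) (x : List α) (r : σ) : List α :=
  E.pre p ++ x ++ E.post r

/-- The two ends add fewer than `2k` letters, which is what fixes the width of the strata. -/
theorem word_mem_stratum (h : A.IsPath p x r) (hx : x.length = 2 * Fintype.card σ * i) :
    E.word p x r ∈ A.stratum (2 * Fintype.card σ) i := by
  have h1 := E.length_pre p
  have h2 := E.length_post r
  obtain ⟨f, hf, hf'⟩ := E.isPath_post r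
  refine ⟨⟨f, hf, ((E.isPath_pre p).append h).append hf'⟩, ?_⟩
  simp only [word, List.length_append, hx]
  rw [show (E.pre p).length + 2 * Fintype.card σ * i + (E.post r).length =
    (E.pre p).length + (E.post r).length + 2 * Fintype.card σ * i by ring,
    Nat.add_mul_div_left _ _ (by omega), Nat.div_eq_of_lt (by omega), zero_add]

theorem pushPopDist_word_le (p r p' r' : σ) (a x b a' b' : List α) :
    pushPopDist (E.word p (a ++ x ++ b) r) (E.word p' (a' ++ x ++ b') r') ≤
      4 * Fintype.card σ + a.length + b.length + a'.length + b'.length := by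
  have h := pushPopDist_le_of_common_factor (E.pre p ++ a) x (b ++ E.post r)
    (E.pre p' ++ a') (b' ++ E.post r')
  have h1 := E.length_pre p
  have h2 := E.length_post r
  have h3 := E.length_pre p'
  have h4 := E.length_post r'
  simp only [List.length_append] at h
  simp only [word, List.append_assoc] at h ⊢
  omega

theorem joined_word_of_same_label {p' r' : σ} (h : A.IsPath p x r) (h' : A.IsPath p' x r')
    (hx : x.length = 2 * Fintype.card σ * i) : A.Joined i (E.word p x r) (E.word p' x r') := by
  refine joined_of_le ?_ (E.word_mem_stratum h hx) (E.word_mem_stratum h' hx)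
  have := E.pushPopDist_word_le p r p' r' [] x [] [] []
  simp only [List.nil_append, List.append_nil, List.length_nil] at this
  omega

/-- Sliding the factor read between the short ends along a path. -/
theorem exists_joined_word_slide (h : A.IsPath p x q) (hy : A.IsPath q v r)
    (hx : x.length = 2 * Fintype.card σ * i) :
    ∃ a m x', x ++ v = a ++ x' ∧ x'.length = 2 * Fintype.card σ * i ∧ A.IsPath p a m ∧
      A.IsPath m x' r ∧ A.Joined i (E.word p x q) (E.word m x' r) := by
  induction v generalizing p x q with
  | nil =>
    obtain rfl := (A.isPath_nil q).unique hy
    exact ⟨[], p, x, by simp, hx, rfl, h, .refl⟩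
  | cons b v ih =>
    obtain ⟨q', hb, hv⟩ := IsPath.split (u := [b]) hy
    have hxb : A.IsPath p (x ++ [b]) q' := h.append hb
    obtain ⟨c, x₁, hc⟩ : ∃ c x₁, x ++ [b] = c :: x₁ := by
      cases x with
      | nil => exact ⟨b, [], rfl⟩
      | cons c x => exact ⟨c, x ++ [b], rfl⟩
    have hlen : x₁.length = x.length := by
      have := congrArg List.length hc
      simpa using this.symm
    rw [hc] at hxb
    obtain ⟨p', hp', hx₁⟩ := IsPath.split (u := [c]) hxb
    obtain ⟨a, m, x', h1, h2, h3, h4, h5⟩ := ih hx₁ hv (hlen.trans hx)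
    refine ⟨c :: a, m, x', ?_, h2, hp'.append h3, h4, .trans ?_ h5⟩
    · rw [List.append_cons, hc, List.cons_append, h1, List.cons_append]
    · refine joined_of_le ?_ (E.word_mem_stratum h hx) (E.word_mem_stratum hx₁ (hlen.trans hx))
      have hk : 0 < Fintype.card σ := Fintype.card_pos_iff.2 ⟨p⟩
      cases x with
      -- An empty window (`i = 0`) has no letter to drop: only the short ends change.
      | nil =>
        have := E.pushPopDist_word_le p q p' q' [] [] [] [] []
        rw [List.eq_nil_of_length_eq_zero hlen]
        simp at this
        omega
      | cons c' x =>
        obtain ⟨rfl, rfl⟩ : c' = c ∧ x ++ [b] = x₁ := by simpa using hc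
        have := E.pushPopDist_word_le p q p' q' [c'] x [] [] [b]
        simp at this
        omega

/-- Slide from `x` along `z ++ x'`: the final window has the length of `x'`, so it is `x'`, and
determinism identifies its starting state. -/
theorem joined_word_of_path {x' z : List α} {q' r' : σ} (h : A.IsPath p x r)
    (hz : A.IsPath r z q') (h' : A.IsPath q' x' r') (hx : x.length = 2 * Fintype.card σ * i)
    (hx' : x'.length = 2 * Fintype.card σ * i) :
    A.Joined i (E.word p x r) (E.word q' x' r') := by
  obtain ⟨a, m, y, h1, h2, h3, h4, h5⟩ := E.exists_joined_word_slide h (hz.append h') hx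
  rw [← List.append_assoc] at h1
  obtain ⟨rfl, rfl⟩ := List.append_inj' h1 (hx'.trans h2.symm)
  rwa [(h.append hz).unique h3, h'.unique (by rwa [(h.append hz).unique h3])]

/-- The windows of the right length that stay within loops at `q` and `q'` are joined. -/
theorem joined_of_linked {q' r' : σ} {x' z z' : List α} (hl : A.Linked q q')
    (h : A.IsPath q x r) (hz : A.IsPath r z q) (h' : A.IsPath q' x' r') (hz' : A.IsPath r' z' q')
    (hx : x.length = 2 * Fintype.card σ * i) (hx' : x'.length = 2 * Fintype.card σ * i) :
    A.Joined i (E.word q x r) (E.word q' x' r') := by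
  obtain ⟨-, -, (⟨y, hy⟩ | ⟨y, hy⟩) | hc⟩ := hl
  · exact E.joined_word_of_path h (hz.append hy) h' hx hx'
  · exact (E.joined_word_of_path h' (hz'.append hy) h hx' hx).symm
  -- Slide into the shared loop at `q`, switch to the same label read from `q'`, slide out; the
  -- switch alters only the short ends.
  · obtain ⟨e, he, h1, h2⟩ := hc.exists_loop
    obtain ⟨s, y, h3, h4⟩ := h1.loopPrefix (2 * Fintype.card σ * i)
    obtain ⟨s', y', h5, h6⟩ := h2.loopPrefix (2 * Fintype.card σ * i)
    have hl := length_loopPrefix he (2 * Fintype.card σ * i)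
    exact ((E.joined_word_of_path h hz h3 hx hl).trans (E.joined_word_of_same_label h3 h5 hl)).trans
      (E.joined_word_of_path h5 h6 h' hl hx')

theorem joined_of_interchangeable {q' r' : σ} {x' z z' : List α}
    (hl : A.InterchangeableStates q q')
    (h : A.IsPath q x r) (hz : A.IsPath r z q) (h' : A.IsPath q' x' r') (hz' : A.IsPath r' z' q')
    (hx : x.length = 2 * Fintype.card σ * i) (hx' : x'.length = 2 * Fintype.card σ * i) :
    A.Joined i (E.word q x r) (E.word q' x' r') := by
  unfold InterchangeableStates at hl
  induction hl generalizing x' r' z' with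
  | single hl => exact E.joined_of_linked hl h hz h' hz' hx hx'
  | tail _ hl ih =>
    obtain ⟨e, he, hb⟩ := loopable_iff.1 hl.1
    obtain ⟨s, y, h3, h4⟩ := hb.loopPrefix (2 * Fintype.card σ * i)
    have hl' := length_loopPrefix he (2 * Fintype.card σ * i)
    exact (ih h3 h4 hl').trans (E.joined_of_linked hl h3 h4 h' hz' hl' hx')

/-- Every word of a stratum other than the first one is joined to a window within a loop. -/
theorem exists_joined_loop (hi : i ≠ 0) (hw : w ∈ A.stratum (2 * Fintype.card σ) i) :
    ∃ q x r z, A.Loopable q ∧ A.IsPath q x r ∧ A.IsPath r z q ∧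
      x.length = 2 * Fintype.card σ * i ∧ A.Joined i w (E.word q x r) := by
  have hk : 0 < Fintype.card σ := Fintype.card_pos_iff.2 ⟨A.start⟩
  have hlow : 2 * Fintype.card σ * i ≤ w.length := by
    rw [← hw.2]; exact Nat.mul_div_le _ _
  have hup : w.length < 2 * Fintype.card σ * i + 2 * Fintype.card σ := by
    have := Nat.lt_mul_div_succ w.length (show 0 < 2 * Fintype.card σ by omega)
    rwa [hw.2, mul_add, mul_one] at this
  have hN : Fintype.card σ ≤ 2 * Fintype.card σ * i := by
    have := Nat.le_mul_of_pos_right (2 * Fintype.card σ) (Nat.pos_of_ne_zero hi)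
    omega
  -- The `k` letters that end at position `N` must contain a loop `b`.
  generalize hNdef : 2 * Fintype.card σ * i = N at *
  obtain ⟨⟨f, hf, hpath⟩, -⟩ := id hw
  obtain ⟨u, v, rest, rfl, hu, hv⟩ : ∃ u v rest, w = u ++ v ++ rest ∧
      u.length = N - Fintype.card σ ∧ v.length = Fintype.card σ := by
    refine ⟨w.take (N - Fintype.card σ), (w.drop (N - Fintype.card σ)).take (Fintype.card σ),
      w.drop N, ?_, ?_, ?_⟩
    · rw [← List.take_add, Nat.sub_add_cancel hN, List.take_append_drop]
    · rw [List.length_take]; omega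
    · rw [List.length_take, List.length_drop]; omega
  obtain ⟨m, hm, -⟩ := hpath.split
  obtain ⟨m', hm', hv'⟩ := hm.split
  obtain ⟨a, b, c, q, rfl, hb, ha, hb', -⟩ := hv'.exists_loop hv.ge
  have hq : A.Loopable q := loopable_iff.2 ⟨b, hb, hb'⟩
  -- The suffix `c` might lead to states from which `q` is unreachable; turning around the loop for
  -- the same number of letters keeps a return to `q` available.
  obtain ⟨s, z, hs, hz⟩ := hb'.loopPrefix (b.length + c.length)
  have hl := length_loopPrefix hb (b.length + c.length)
  obtain ⟨s', z', hs', hz'⟩ := hb'.loopPrefix N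
  have hl' := length_loopPrefix hb N
  have hx : A.IsPath A.start (u ++ a ++ PartialDFA.loopPrefix b (b.length + c.length)) s :=
    (hm'.append ha).append hs
  have hxl : (u ++ a ++ PartialDFA.loopPrefix b (b.length + c.length)).length =
      2 * Fintype.card σ * i := by
    simp only [List.length_append, hl] at hv ⊢
    omega
  refine ⟨q, _, s', z', hq, hs', hz', hl', .trans (joined_of_le ?_ hw (E.word_mem_stratum hx hxl))
    (E.joined_word_of_path hx hz hs' hxl (hl'.trans hNdef.symm))⟩
  -- With `u ++ a` kept, fewer than `3k` letters are removed and fewer than `3k` inserted.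
  have h1 := pushPopDist_le_of_common_factor [] (u ++ a) (b ++ c ++ rest) (E.pre A.start)
    (PartialDFA.loopPrefix b (b.length + c.length) ++ E.post s)
  have h2 := E.length_pre A.start
  have h3 := E.length_post s
  simp only [List.length_append, hl, List.length_nil] at h1 hv hup
  simp only [word, List.append_assoc, List.nil_append] at h1 ⊢
  omega

theorem joined_of_mem_stratum (E : A.ShortEnds) (hInt : A.IsInterchangeable)
    (hu : u ∈ A.stratum (2 * Fintype.card σ) i) (hv : v ∈ A.stratum (2 * Fintype.card σ) i) :
    A.Joined i u v := by
  by_cases hi : i = 0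
  · subst hi
    have hk : 0 < Fintype.card σ := Fintype.card_pos_iff.2 ⟨A.start⟩
    have h1 := (Nat.div_eq_zero_iff_lt (by omega)).1 hu.2
    have h2 := (Nat.div_eq_zero_iff_lt (by omega)).1 hv.2
    refine joined_of_le ?_ hu hv
    have := pushPopDist_le_of_common_factor u [] [] v []
    simp only [List.append_nil, List.length_nil] at this
    omega
  · obtain ⟨q, x, r, z, hq, h, hz, hx, hj⟩ := E.exists_joined_loop hi hu
    obtain ⟨q', x', r', z', hq', h', hz', hx', hj'⟩ := E.exists_joined_loop hi hv
    exact (hj.trans (E.joined_of_interchangeable (hInt q q' hq hq') h hz h' hz' hx hx')).trans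
      hj'.symm

end ShortEnds

/-- Without loops all words are shorter than `k`, so the language is finite and any enumeration of
it will do. -/
theorem isOrderable_of_not_loopable [Finite α] [Fintype σ] (h : ∀ q, ¬ A.Loopable q) :
    IsOrderable pushPopDist (48 * Fintype.card σ ^ 2) A.language := by
  have hlen : ∀ w ∈ A.language, w.length < Fintype.card σ := by
    rintro w ⟨f, -, hw⟩
    by_contra! hc
    obtain ⟨a, b, c, q, -, hb, -, hq, -⟩ := hw.exists_loop hc
    exact h q (loopable_iff.2 ⟨b, hb, hq⟩)
  have hfin : (A.language : Set (List α)).Finite :=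
    (List.finite_length_lt α (Fintype.card σ)).subset hlen
  refine Or.inl ⟨hfin.toFinset.toList, ⟨?_, Finset.nodup_toList _, ?_⟩, ?_⟩
  · intro w hw
    exact hfin.mem_toFinset.1 (Finset.mem_toList.1 hw)
  · refine List.Pairwise.isChain ?_
    refine List.pairwise_of_forall_mem_list ?_
    intro u hu v hv
    have h1 := hlen u (hfin.mem_toFinset.1 (Finset.mem_toList.1 hu))
    have h2 := hlen v (hfin.mem_toFinset.1 (Finset.mem_toList.1 hv))
    have h3 := pushPopDist_le_of_common_factor u [] [] v []
    simp only [List.append_nil, List.length_nil] at h3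
    nlinarith [Nat.le_self_pow two_ne_zero (Fintype.card σ)]
  · intro w hw
    exact Finset.mem_toList.2 (hfin.mem_toFinset.2 hw)

end PartialDFA

/-! ### Chaining the strata. -/

open PartialDFA CubeHamiltonian in
theorem mainTheorem1 {α σ : Type*} [Finite α] [Fintype σ] (A : PartialDFA α σ)
    (hTrim : A.IsTrimmed) (hInt : A.IsInterchangeable) :
    IsOrderable pushPopDist (48 * Fintype.card σ ^ 2) A.language := by
  by_cases hloop : ∃ q, A.Loopable q
  swap
  · exact isOrderable_of_not_loopable (not_exists.1 hloop)
  obtain ⟨q, hq⟩ := hloop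
  obtain ⟨e, he, hqe⟩ := loopable_iff.1 hq
  obtain ⟨E⟩ := hTrim.nonempty_shortEnds
  set k := Fintype.card σ with hk
  have hk0 : 0 < k := Fintype.card_pos_iff.2 ⟨q⟩
  have hkk : k ≤ k ^ 2 := Nat.le_self_pow two_ne_zero k
  let R : List α → List α → Prop := fun u v => pushPopDist u v ≤ 16 * k ^ 2
  have hr : ∀ u, R u u := fun u => by simp [R, pushPopDist_self]
  have hs : ∀ u v, R u v → R v u := fun u v h => (pushPopDist_comm_le u v).trans h
  have hfin := A.finite_stratum (m := 2 * k) (by omega)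
  have hconn : ∀ i, ConnectedOn R (hfin i).toFinset := by
    intro i u hu v hv
    simp only [Set.Finite.mem_toFinset] at hu hv ⊢
    exact E.joined_of_mem_stratum hInt hu hv
  choose t _ ht _ using fun n => hqe.loopPrefix n
  -- Anchors of the strata, all read around the same loop: consecutive ones differ by `2k` window
  -- letters and the short ends, hence by at most `6k`.
  let c : ℕ → List α := fun i => E.word q (loopPrefix e (2 * k * i)) (t (2 * k * i))
  have hc : ∀ i, c i ∈ (hfin i).toFinset := fun i =>
    (hfin i).mem_toFinset.2 (E.word_mem_stratum (ht _) (length_loopPrefix he _))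
  have hcc : ∀ i, pushPopDist (c i) (c (i + 1)) ≤ 16 * k ^ 2 := by
    intro i
    obtain ⟨v, hv, hv'⟩ := loopPrefix_add he (2 * k * i) (2 * k)
    have := E.pushPopDist_word_le q (t (2 * k * i)) q (t (2 * k * (i + 1))) []
      (loopPrefix e (2 * k * i)) [] [] v
    simp only [c, mul_add, mul_one, hv']
    simp only [List.append_nil, List.nil_append, List.length_nil, hv, mul_add, mul_one] at this
    omega
  -- The list of stratum `i` ends at the anchor `c i` and starts at `f i`, which is within `16k²` of
  -- it. Passing from `c i` through `c (i + 1)` to `f (i + 1)` thus costs at most `32k²`.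
  choose f hf l hl using fun i => (hconn i).exists_isHamiltonian_to hr hs (hc i)
  obtain ⟨s, hinj, hstep, hmem, hall⟩ := exists_seq_of_lists
    (fun u v => pushPopDist u v ≤ 48 * k ^ 2) l
    (fun i h => by simpa [h] using (hl i).head) (fun i => (hl i).nodup)
    (fun i j x hi hj => by
      rw [(hl _).mem_iff, Set.Finite.mem_toFinset] at hi hj
      exact hi.2.symm.trans hj.2)
    (fun i => (hl i).chain.imp fun u v ⟨a, b, h1, h2, h3⟩ => by
      have h4 := pushPopDist_triangle u a v
      have h5 := pushPopDist_triangle a b v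
      simp only [R] at h1 h2 h3
      omega)
    (fun i x hx y hy => by
      rw [(hl i).last] at hx
      rw [(hl (i + 1)).head] at hy
      cases hx
      cases hy
      have h1 := pushPopDist_triangle (c i) (c (i + 1)) (f (i + 1))
      have h2 := hcc i
      have h3 : pushPopDist _ _ ≤ _ := hs _ _ (hf (i + 1))
      omega)
  refine Or.inr ⟨s, ⟨fun n => ?_, hinj, hstep⟩, fun w hw => ?_⟩
  · obtain ⟨i, hi⟩ := hmem n
    exact ((hfin i).mem_toFinset.1 (((hl i).mem_iff _).1 hi)).1
  · exact hall (w.length / (2 * k)) w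
      (((hl _).mem_iff _).2 ((hfin _).mem_toFinset.2 ⟨hw, rfl⟩))
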